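/- **Theorem.** Let $G$ be a locally compact (Hausdorff) group, let $C_{00}(G)\subseteq C_0(G)$ be the spaces of complex continuous functions on $G$ that have compact support, respectively vanish at infinity, and let $M(G)$ be the space of bounded regular complex Borel measures on $G$, normed by total variation, $\|\mu\|=|\mu|(G)$. For $\mu_1,\mu_2\in M(G)$ let $\mu_1*\mu_2\in M(G)$ denote their convolution, determined by $$\int f\,d(\mu_1*\mu_2)=\int\!\!\int f(xy)\,d\mu_1(x)\,d\mu_2(y)\qquad (f\in C_{00}(G)).$$ For $\mu\in M(G)$ let $\mu^n$ be its $n$-th convolution power and, for $n\ge 1$, put $\mu_{[n]}=\frac1n(\mu+\mu^2+\cdots+\mu^n)$. If the sequence $(\|\mu^n\|)_{n\ge 1}$ is bounded, then $\mu$ is vague-ergodic, that is, there is a measure $\mu_c\in M(G)$ such that $\mu_{[n]}\to\mu_c$ in the vague topology $\sigma(M(G),C_0(G))$: $$\lim_{n\to\infty}\int f\,d\mu_{[n]}=\int f\,d\mu_c\qquad\text{for every } f\in C_0(G).$$ -/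

import Mathlib

set_option linter.unusedSectionVars false

noncomputable section

namespace VagueErgodic

open MeasureTheory Filter Topology Set
open scoped ENNReal NNReal ZeroAtInfty CompactlySupported Pointwise

/-! ### Bounded complex regular Borel measures -/

section Space

variable {X : Type*} [MeasurableSpace X]

/-- The total variation of a complex measure is always a finite measure. -/
instance isFiniteMeasure_variation (μ : ComplexMeasure X) : IsFiniteMeasure μ.variation := by
  refine isFiniteMeasure_of_le
    ((ComplexMeasure.re μ).totalVariation + (ComplexMeasure.im μ).totalVariation) ?_
  refine VectorMeasure.variation_le_of_forall_enorm_le fun E _ ↦ ?_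
  have h1 := SignedMeasure.enorm_le_totalVariation (ComplexMeasure.re μ) E
  have h2 := SignedMeasure.enorm_le_totalVariation (ComplexMeasure.im μ) E
  have h3 : μ E = ((ComplexMeasure.re μ E : ℝ) : ℂ)
      + ((ComplexMeasure.im μ E : ℝ) : ℂ) * Complex.I := by
    exact (Complex.re_add_im (μ E)).symm
  calc ‖μ E‖ₑ ≤ ‖ComplexMeasure.re μ E‖ₑ + ‖ComplexMeasure.im μ E‖ₑ := by
        rw [h3]
        refine (enorm_add_le _ _).trans (le_of_eq ?_)
        simp [← ofReal_norm]
    _ ≤ _ := add_le_add h1 h2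

variable [TopologicalSpace X] [T2Space X] [BorelSpace X]

/-- A measure dominated by a finite regular measure is regular. -/
theorem regular_of_le {m m' : Measure X} [IsFiniteMeasure m'] [m'.Regular] (h : m ≤ m') :
    m.Regular := by
  have : IsFiniteMeasure m := isFiniteMeasure_of_le _ h
  have : m.InnerRegular := by
    refine ⟨fun U hU r hr ↦ ?_⟩
    have hpos : m U - r ≠ 0 := (tsub_pos_of_lt hr).ne'
    obtain ⟨K, hKU, hK, hlt⟩ :=
      hU.exists_isCompact_sdiff_lt (measure_ne_top m' U) hpos
    refine ⟨K, hKU, hK, ?_⟩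
    by_contra hcon
    have h1 : m U ≤ m K + m (U \ K) := by
      rw [← measure_union disjoint_sdiff_right (hU.diff hK.measurableSet)]
      exact measure_mono (by simp)
    have h2 : m (U \ K) < m U - r := (h _).trans_lt hlt
    have h3 : m U < r + (m U - r) :=
      h1.trans_lt (ENNReal.add_lt_add_of_le_of_lt (measure_ne_top _ _) (not_lt.1 hcon) h2)
    rw [add_tsub_cancel_of_le hr.le] at h3
    exact lt_irrefl _ h3
  infer_instance

variable (X) in
/-- `M X`: the complex vector space of bounded regular complex Borel measures on `X`, i.e. of the
complex measures whose total variation is a regular measure. -/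
def M : Submodule ℂ (ComplexMeasure X) where
  carrier := {μ | μ.variation.Regular}
  add_mem' {μ ν} hμ hν := by
    have h1 : μ.variation.Regular := hμ
    have h2 : ν.variation.Regular := hν
    have : (μ.variation + ν.variation).Regular := inferInstance
    exact regular_of_le VectorMeasure.variation_add_le
  zero_mem' := by
    change (VectorMeasure.variation (0 : ComplexMeasure X)).Regular
    rw [VectorMeasure.variation_zero]
    infer_instance
  smul_mem' c μ hμ := by
    have h1 : μ.variation.Regular := hμ
    change (VectorMeasure.variation (c • μ)).Regular
    rw [VectorMeasure.variation_smul]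
    infer_instance

/-- The total variation norm `‖μ‖ = |μ|(X)`. -/
instance : Norm (M X) := ⟨fun μ ↦ (μ.1.variation univ).toReal⟩

end Space

/-- The integral `∫ f dμ` of a complex function against a complex measure. -/
def cintegral {X : Type*} [MeasurableSpace X] (μ : ComplexMeasure X) (f : X → ℂ) : ℂ :=
  μ.integral f (ContinuousLinearMap.mul ℝ ℂ)

/-! ### Auxiliary facts on the integral, used to construct convolutions -/

section Integral

variable {X : Type*} [MeasurableSpace X]

theorem cintegral_add {μ ν : ComplexMeasure X} {f : X → ℂ}
    (hμ : μ.Integrable f) (hν : ν.Integrable f) :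
    cintegral (μ + ν) f = cintegral μ f + cintegral ν f :=
  VectorMeasure.integral_add_vectorMeasure hμ hν

theorem cintegral_neg (μ : ComplexMeasure X) (f : X → ℂ) :
    cintegral (-μ) f = -cintegral μ f :=
  VectorMeasure.integral_neg_vectorMeasure

theorem cintegral_fun_add {μ : ComplexMeasure X} {f g : X → ℂ}
    (hf : μ.Integrable f) (hg : μ.Integrable g) :
    cintegral μ (fun x ↦ f x + g x) = cintegral μ f + cintegral μ g :=
  VectorMeasure.integral_fun_add hf hg

theorem cintegral_const_mul (μ : ComplexMeasure X) (c : ℂ) (f : X → ℂ) :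
    cintegral μ (fun x ↦ c * f x) = c * cintegral μ f := by
  refine setToFun_smul (𝕜 := ℂ) _ (fun c s x ↦ ?_) c f
  change (c * x) * μ s = c * (x * μ s)
  ring

theorem variation_I_smul (μ : ComplexMeasure X) :
    (Complex.I • μ).variation = μ.variation := by
  simp [VectorMeasure.variation_smul]

theorem cintegral_I_smul (μ : ComplexMeasure X) {f : X → ℂ} (hf : μ.Integrable f) :
    cintegral (Complex.I • μ) f = Complex.I * cintegral μ f := by
  have hd : DominatedFinMeasAdditive μ.variation
      ((Complex.I • μ).transpose (ContinuousLinearMap.mul ℝ ℂ)) ‖ContinuousLinearMap.mul ℝ ℂ‖ := by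
    have := dominatedFinMeasAdditive_cbmApplyMeasure (Complex.I • μ) (ContinuousLinearMap.mul ℝ ℂ)
    rwa [variation_I_smul] at this
  have h1 : cintegral (Complex.I • μ) f = setToFun μ.variation _ hd f := by
    unfold cintegral VectorMeasure.integral
    congr 1
    exact variation_I_smul μ
  rw [h1]
  change _ = Complex.I * setToFun μ.variation _
    (dominatedFinMeasAdditive_cbmApplyMeasure μ (ContinuousLinearMap.mul ℝ ℂ)) f
  refine Integrable.induction (P := fun f ↦ setToFun μ.variation _ hd f
    = Complex.I * setToFun μ.variation _
      (dominatedFinMeasAdditive_cbmApplyMeasure μ (ContinuousLinearMap.mul ℝ ℂ)) f) ?_ ?_ ?_ ?_ hf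
  · intro c s hs hμs
    rw [setToFun_indicator_const _ hs hμs.ne, setToFun_indicator_const _ hs hμs.ne]
    change c * (Complex.I * μ s) = Complex.I * (c * μ s)
    ring
  · intro f g _ hf hg h1 h2
    beta_reduce at h1 h2 ⊢
    rw [setToFun_add _ hf hg, setToFun_add _ hf hg, h1, h2]
    ring
  · exact isClosed_eq (continuous_setToFun hd) (continuous_const.mul (continuous_setToFun _))
  · intro f g hfg _ h
    beta_reduce at h ⊢
    rw [← setToFun_congr_ae _ hfg, ← setToFun_congr_ae _ hfg, h]

/-- A finite positive measure, seen as a complex measure. -/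
def toComplex (m : Measure X) [IsFiniteMeasure m] : ComplexMeasure X :=
  m.toSignedMeasure.toComplexMeasure 0

theorem toComplex_apply (m : Measure X) [IsFiniteMeasure m] {s : Set X} (hs : MeasurableSet s) :
    toComplex m s = ((m.real s : ℝ) : ℂ) := by
  rw [toComplex, SignedMeasure.toComplexMeasure_apply,
    Measure.toSignedMeasure_apply_measurable hs]
  rfl

theorem variation_toComplex_le (m : Measure X) [IsFiniteMeasure m] :
    (toComplex m).variation ≤ m := by
  refine VectorMeasure.variation_le_of_forall_enorm_le fun E hE ↦ ?_
  rw [toComplex_apply m hE, ← ofReal_norm, Complex.norm_real, Real.norm_of_nonneg (by simp)]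
  simp

theorem cintegral_toComplex (m : Measure X) [IsFiniteMeasure m] (f : X → ℂ) :
    cintegral (toComplex m) f = ∫ x, f x ∂m := by
  have hv : (toComplex m).variation = m := by
    refine le_antisymm (variation_toComplex_le m) (Measure.le_intro fun s hs _ ↦ ?_)
    refine le_trans ?_ (VectorMeasure.enorm_measure_le_variation (toComplex m) s)
    rw [toComplex_apply m hs, ← ofReal_norm, Complex.norm_real, Real.norm_of_nonneg (by simp)]
    simp
  have hd : DominatedFinMeasAdditive m
      ((toComplex m).transpose (ContinuousLinearMap.mul ℝ ℂ)) ‖ContinuousLinearMap.mul ℝ ℂ‖ := by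
    have := dominatedFinMeasAdditive_cbmApplyMeasure (toComplex m) (ContinuousLinearMap.mul ℝ ℂ)
    rwa [hv] at this
  have h1 : cintegral (toComplex m) f = setToFun m _ hd f := by
    unfold cintegral VectorMeasure.integral
    congr 1
  rw [h1, integral_eq_setToFun]
  refine setToFun_congr_left' _ _ (fun s hs _ ↦ ?_) f
  ext x
  · change x * toComplex m s = m.real s • x
    rw [toComplex_apply m hs, Complex.real_smul, mul_comm]

/-- Every complex measure is a combination of four finite positive measures dominated by its total
variation. -/
theorem exists_decomp (μ : ComplexMeasure X) :
    ∃ (a b c d : Measure X) (_ : IsFiniteMeasure a) (_ : IsFiniteMeasure b)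
      (_ : IsFiniteMeasure c) (_ : IsFiniteMeasure d),
      a ≤ μ.variation ∧ b ≤ μ.variation ∧ c ≤ μ.variation ∧ d ≤ μ.variation ∧
      μ = (toComplex a + -toComplex b) + Complex.I • (toComplex c + -toComplex d) := by
  have key : ∀ s : SignedMeasure X, (∀ E, MeasurableSet E → ‖s E‖ₑ ≤ ‖μ E‖ₑ) →
      s.totalVariation ≤ μ.variation := by
    intro s hs
    rw [SignedMeasure.totalVariation_eq_variation]
    exact VectorMeasure.variation_le_of_forall_enorm_le fun E hE ↦
      (hs E hE).trans (VectorMeasure.enorm_measure_le_variation μ E)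
  have hre : (ComplexMeasure.re μ).totalVariation ≤ μ.variation := key _ fun E _ ↦ by
    rw [← ofReal_norm, ← ofReal_norm]
    exact ENNReal.ofReal_le_ofReal (Complex.abs_re_le_norm (μ E))
  have him : (ComplexMeasure.im μ).totalVariation ≤ μ.variation := key _ fun E _ ↦ by
    rw [← ofReal_norm, ← ofReal_norm]
    exact ENNReal.ofReal_le_ofReal (Complex.abs_im_le_norm (μ E))
  refine ⟨(ComplexMeasure.re μ).toJordanDecomposition.posPart,
    (ComplexMeasure.re μ).toJordanDecomposition.negPart,
    (ComplexMeasure.im μ).toJordanDecomposition.posPart,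
    (ComplexMeasure.im μ).toJordanDecomposition.negPart, inferInstance, inferInstance,
    inferInstance, inferInstance, le_trans (Measure.le_add_right le_rfl) hre,
    le_trans (Measure.le_add_left le_rfl) hre, le_trans (Measure.le_add_right le_rfl) him,
    le_trans (Measure.le_add_left le_rfl) him, ?_⟩
  ext s hs
  have h1 := SignedMeasure.apply_eq_posPart_real_sub_negPart_real (ComplexMeasure.re μ) hs
  have h2 := SignedMeasure.apply_eq_posPart_real_sub_negPart_real (ComplexMeasure.im μ) hs
  have h3 : μ s = ((ComplexMeasure.re μ s : ℝ) : ℂ)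
      + ((ComplexMeasure.im μ s : ℝ) : ℂ) * Complex.I := (Complex.re_add_im (μ s)).symm
  rw [h3, h1, h2]
  simp only [add_apply, neg_apply, smul_apply,
    toComplex_apply _ hs]
  push_cast
  simp only [smul_eq_mul]
  ring

end Integral

/-! ### Convolution -/

section Convolution

variable {G : Type*} [Group G] [TopologicalSpace G] [IsTopologicalGroup G] [MeasurableSpace G]

/-- `ρ` is a convolution `μ ∗ ν`, i.e. `∫ f dρ = ∫∫ f(xy) dμ(x) dν(y)` for all continuous
compactly supported `f`. -/
def IsConv (ρ μ ν : ComplexMeasure G) : Prop :=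
  ∀ f : C_c(G, ℂ), cintegral ρ f = cintegral ν fun y ↦ cintegral μ fun x ↦ f (x * y)

variable [BorelSpace G]

theorem exists_bound {E : Type*} [NormedAddCommGroup E] (f : C_c(G, E)) :
    ∃ C, 0 ≤ C ∧ ∀ x, ‖f x‖ ≤ C := by
  obtain ⟨C, hC⟩ := f.hasCompactSupport.exists_bound_of_continuous f.continuous
  exact ⟨C, (norm_nonneg _).trans (hC 1), hC⟩

theorem integrable_translate {E : Type*} [NormedAddCommGroup E]
    (m : Measure G) [IsFiniteMeasure m] (f : C_c(G, E)) (y : G) :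
    Integrable (fun x ↦ f (x * y)) m := by
  refine Continuous.integrable_of_hasCompactSupport (by fun_prop) ?_
  exact f.hasCompactSupport.comp_homeomorph (Homeomorph.mulRight y)

theorem cintegral_congr_decomp {μ : ComplexMeasure G} {a b c d : Measure G} [IsFiniteMeasure a]
    [IsFiniteMeasure b] [IsFiniteMeasure c] [IsFiniteMeasure d]
    (h : μ = (toComplex a + -toComplex b) + Complex.I • (toComplex c + -toComplex d))
    {f : G → ℂ} (ha : Integrable f a) (hb : Integrable f b) (hc : Integrable f c)
    (hd : Integrable f d) :
    cintegral μ f = (∫ x, f x ∂a - ∫ x, f x ∂b)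
      + Complex.I * (∫ x, f x ∂c - ∫ x, f x ∂d) := by
  have ha' : (toComplex a).Integrable f := ha.mono_measure (variation_toComplex_le a)
  have hb' : (toComplex b).Integrable f := hb.mono_measure (variation_toComplex_le b)
  have hc' : (toComplex c).Integrable f := hc.mono_measure (variation_toComplex_le c)
  have hd' : (toComplex d).Integrable f := hd.mono_measure (variation_toComplex_le d)
  have h1 := ha'.add_vectorMeasure hb'.neg_vectorMeasure
  have h2 := hc'.add_vectorMeasure hd'.neg_vectorMeasure
  have h3 : (Complex.I • (toComplex c + -toComplex d)).Integrable f := by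
    unfold VectorMeasure.Integrable at h2 ⊢
    rwa [variation_I_smul]
  rw [h, cintegral_add h1 h3, cintegral_I_smul _ h2, cintegral_add ha' hb'.neg_vectorMeasure,
    cintegral_add hc' hd'.neg_vectorMeasure, cintegral_neg, cintegral_neg]
  simp only [cintegral_toComplex]
  ring

variable [LocallyCompactSpace G]

theorem continuous_inner_measure {E : Type*} [NormedAddCommGroup E] [NormedSpace ℝ E]
    (m : Measure G) [IsFiniteMeasure m] (f : C_c(G, E)) :
    Continuous fun y ↦ ∫ x, f (x * y) ∂m := by
  refine continuous_iff_continuousAt.2 fun y₀ ↦ ?_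
  obtain ⟨t, t_comp, ht⟩ := exists_compact_mem_nhds y₀
  have hk : IsCompact (tsupport f * t⁻¹) := IsCompact.mul f.hasCompactSupport t_comp.inv
  have A : ContinuousOn (fun y : G ↦ ∫ x, f (x * y) ∂m) t := by
    refine continuousOn_integral_of_compact_support hk ?_ ?_
    · have : Continuous fun p : G × G ↦ f (p.2 * p.1) := by fun_prop
      exact this.continuousOn
    · intro p x hp hx
      contrapose! hx
      exact ⟨x * p, subset_tsupport _ hx, p⁻¹, by simpa using hp, by simp⟩
  exact A.continuousAt ht

theorem continuous_inner (μ : ComplexMeasure G) (f : C_c(G, ℂ)) :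
    Continuous fun y ↦ cintegral μ fun x ↦ f (x * y) := by
  obtain ⟨a, b, c, d, _, _, _, _, _, _, _, _, h⟩ := exists_decomp μ
  have : (fun y ↦ cintegral μ fun x ↦ f (x * y)) = fun y ↦
      (∫ x, f (x * y) ∂a - ∫ x, f (x * y) ∂b)
      + Complex.I * (∫ x, f (x * y) ∂c - ∫ x, f (x * y) ∂d) := by
    funext y
    exact cintegral_congr_decomp h (integrable_translate a f y) (integrable_translate b f y)
      (integrable_translate c f y) (integrable_translate d f y)
  rw [this]
  exact ((continuous_inner_measure a f).sub (continuous_inner_measure b f)).add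
    (continuous_const.mul ((continuous_inner_measure c f).sub (continuous_inner_measure d f)))

theorem integrable_inner (μ : ComplexMeasure G) (n : Measure G) [IsFiniteMeasure n]
    (f : C_c(G, ℂ)) : Integrable (fun y ↦ cintegral μ fun x ↦ f (x * y)) n := by
  obtain ⟨C, hC0, hC⟩ := exists_bound f
  refine Integrable.of_bound (continuous_inner μ f).aestronglyMeasurable
    (C * ‖ContinuousLinearMap.mul ℝ ℂ‖ * μ.variation.real univ) (ae_of_all _ fun y ↦ ?_)
  exact VectorMeasure.norm_integral_le_of_norm_le_const (ae_of_all _ fun x ↦ hC _)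

theorem integrable_inner_measure (m n : Measure G) [IsFiniteMeasure m] [IsFiniteMeasure n]
    (f : C_c(G, ℝ)) : Integrable (fun y ↦ ∫ x, f (x * y) ∂m) n := by
  obtain ⟨C, hC0, hC⟩ := exists_bound f
  refine Integrable.of_bound (continuous_inner_measure m f).aestronglyMeasurable
    (C * m.real univ) (ae_of_all _ fun y ↦ ?_)
  exact norm_integral_le_of_norm_le_const (ae_of_all _ fun x ↦ hC _)

variable [T2Space G]

theorem exists_conv_measure (m n : Measure G) [IsFiniteMeasure m] [IsFiniteMeasure n] :
    ∃ (ρ : Measure G) (_ : IsFiniteMeasure ρ), ρ.Regular ∧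
      ∀ f : C_c(G, ℝ), ∫ x, f x ∂ρ = ∫ y, ∫ x, f (x * y) ∂m ∂n := by
  let Λ : C_c(G, ℝ) →ₚ[ℝ] ℝ := PositiveLinearMap.mk₀
    { toFun f := ∫ y, ∫ x, f (x * y) ∂m ∂n
      map_add' f g := by
        rw [← integral_add (integrable_inner_measure m n f) (integrable_inner_measure m n g)]
        congr 1
        funext y
        exact integral_add (integrable_translate m f y) (integrable_translate m g y)
      map_smul' c f := by
        simp only [CompactlySupportedContinuousMap.smul_apply, smul_eq_mul, integral_const_mul,
          RingHom.id_apply] }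
    fun f hf ↦ integral_nonneg fun y ↦ integral_nonneg fun x ↦ hf _
  have hΛ : ∀ f : C_c(G, ℝ), Λ f = ∫ y, ∫ x, f (x * y) ∂m ∂n := fun f ↦ rfl
  refine ⟨RealRMK.rieszMeasure Λ, ⟨?_⟩, inferInstance, fun f ↦ ?_⟩
  · have hK : ∀ K : Set G, IsCompact K →
        RealRMK.rieszMeasure Λ K ≤ ENNReal.ofReal (1 * m.real univ * n.real univ) := by
      intro K hK
      obtain ⟨f, h1, -, hc, h01⟩ := exists_continuous_one_zero_of_isCompact hK
        (isClosed_empty (X := G)) (disjoint_empty K)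
      let g : C_c(G, ℝ) := ⟨f, hc⟩
      refine (RealRMK.rieszMeasure_le_of_eq_one Λ (f := g) (fun x ↦ (h01 x).1) hK
        (fun x hx ↦ h1 hx)).trans (ENNReal.ofReal_le_ofReal ?_)
      rw [hΛ]
      refine (le_abs_self _).trans ?_
      have h2 : ∀ y, ‖∫ x, f (x * y) ∂m‖ ≤ 1 * m.real univ := fun y ↦
        norm_integral_le_of_norm_le_const (ae_of_all _ fun x ↦ by
          rw [Real.norm_of_nonneg (h01 _).1]
          exact (h01 _).2)
      exact norm_integral_le_of_norm_le_const (μ := n) (ae_of_all _ h2)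
    rw [isOpen_univ.measure_eq_iSup_isCompact]
    exact (iSup₂_le fun K _ ↦ iSup_le fun hc ↦ hK K hc).trans_lt ENNReal.ofReal_lt_top
  · rw [RealRMK.integral_rieszMeasure, hΛ]

theorem exists_conv_toComplex (m n : Measure G) [IsFiniteMeasure m] [IsFiniteMeasure n] :
    ∃ ρ ∈ M G, IsConv ρ (toComplex m) (toComplex n) := by
  obtain ⟨ρ, hfin, hreg, h⟩ := exists_conv_measure m n
  refine ⟨toComplex ρ, regular_of_le (variation_toComplex_le ρ), fun f ↦ ?_⟩
  simp only [cintegral_toComplex]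
  let u : C_c(G, ℝ) := ⟨⟨fun x ↦ (f x).re, by fun_prop⟩,
    f.hasCompactSupport.comp_left (g := Complex.re) Complex.zero_re⟩
  let v : C_c(G, ℝ) := ⟨⟨fun x ↦ (f x).im, by fun_prop⟩,
    f.hasCompactSupport.comp_left (g := Complex.im) Complex.zero_im⟩
  have hu : ∀ x, u x = (f x).re := fun x ↦ rfl
  have hv : ∀ x, v x = (f x).im := fun x ↦ rfl
  have e : ∀ x, f x = (u x : ℂ) + (v x : ℂ) * Complex.I := fun x ↦ by
    rw [hu, hv, Complex.re_add_im]
  have e1 : ∀ y, ∫ x, f (x * y) ∂m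
      = ((∫ x, u (x * y) ∂m : ℝ) : ℂ) + ((∫ x, v (x * y) ∂m : ℝ) : ℂ) * Complex.I := by
    intro y
    simp only [e]
    rw [integral_add (integrable_translate m u y).ofReal
      ((integrable_translate m v y).ofReal.mul_const _), integral_mul_const, integral_complex_ofReal,
      integral_complex_ofReal]
  simp only [e1]
  simp only [e]
  rw [integral_add u.integrable.ofReal (v.integrable.ofReal.mul_const _),
    integral_add (integrable_inner_measure m n u).ofReal
      ((integrable_inner_measure m n v).ofReal.mul_const _), integral_mul_const,
    integral_mul_const, integral_complex_ofReal, integral_complex_ofReal, integral_complex_ofReal,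
    integral_complex_ofReal, h, h]

theorem exists_conv_add_right {μ ν ν' : ComplexMeasure G} (h : ∃ ρ ∈ M G, IsConv ρ μ ν)
    (h' : ∃ ρ ∈ M G, IsConv ρ μ ν') : ∃ ρ ∈ M G, IsConv ρ μ (ν + ν') := by
  obtain ⟨ρ, hρ, h⟩ := h
  obtain ⟨ρ', hρ', h'⟩ := h'
  refine ⟨ρ + ρ', (M G).add_mem hρ hρ', fun f ↦ ?_⟩
  rw [cintegral_add f.integrable f.integrable, h, h',
    cintegral_add (integrable_inner _ _ f) (integrable_inner _ _ f)]

theorem exists_conv_neg_right {μ ν : ComplexMeasure G} (h : ∃ ρ ∈ M G, IsConv ρ μ ν) :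
    ∃ ρ ∈ M G, IsConv ρ μ (-ν) := by
  obtain ⟨ρ, hρ, h⟩ := h
  refine ⟨-ρ, (M G).neg_mem hρ, fun f ↦ ?_⟩
  rw [cintegral_neg, cintegral_neg, h]

theorem exists_conv_I_smul_right {μ ν : ComplexMeasure G} (h : ∃ ρ ∈ M G, IsConv ρ μ ν) :
    ∃ ρ ∈ M G, IsConv ρ μ (Complex.I • ν) := by
  obtain ⟨ρ, hρ, h⟩ := h
  refine ⟨Complex.I • ρ, (M G).smul_mem _ hρ, fun f ↦ ?_⟩
  rw [cintegral_I_smul _ f.integrable, cintegral_I_smul _ (integrable_inner _ _ f), h]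

theorem exists_conv_add_left {μ μ' ν : ComplexMeasure G} (h : ∃ ρ ∈ M G, IsConv ρ μ ν)
    (h' : ∃ ρ ∈ M G, IsConv ρ μ' ν) : ∃ ρ ∈ M G, IsConv ρ (μ + μ') ν := by
  obtain ⟨ρ, hρ, h⟩ := h
  obtain ⟨ρ', hρ', h'⟩ := h'
  refine ⟨ρ + ρ', (M G).add_mem hρ hρ', fun f ↦ ?_⟩
  rw [cintegral_add f.integrable f.integrable, h, h',
    ← cintegral_fun_add (integrable_inner _ _ f) (integrable_inner _ _ f)]
  congr 1
  funext y
  exact (cintegral_add (integrable_translate _ f y) (integrable_translate _ f y)).symm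

theorem exists_conv_neg_left {μ ν : ComplexMeasure G} (h : ∃ ρ ∈ M G, IsConv ρ μ ν) :
    ∃ ρ ∈ M G, IsConv ρ (-μ) ν := by
  obtain ⟨ρ, hρ, h⟩ := h
  refine ⟨-ρ, (M G).neg_mem hρ, fun f ↦ ?_⟩
  have := cintegral_const_mul ν (-1) fun y ↦ cintegral μ fun x ↦ f (x * y)
  simp only [neg_mul, one_mul] at this
  rw [cintegral_neg, h, ← this]
  simp only [cintegral_neg]

theorem exists_conv_I_smul_left {μ ν : ComplexMeasure G} (h : ∃ ρ ∈ M G, IsConv ρ μ ν) :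
    ∃ ρ ∈ M G, IsConv ρ (Complex.I • μ) ν := by
  obtain ⟨ρ, hρ, h⟩ := h
  refine ⟨Complex.I • ρ, (M G).smul_mem _ hρ, fun f ↦ ?_⟩
  rw [cintegral_I_smul _ f.integrable, h, ← cintegral_const_mul]
  congr 1
  funext y
  exact (cintegral_I_smul _ (integrable_translate _ f y)).symm

theorem exists_conv (μ ν : ComplexMeasure G) : ∃ ρ ∈ M G, IsConv ρ μ ν := by
  obtain ⟨a, b, c, d, _, _, _, _, _, _, _, _, h⟩ := exists_decomp μ
  obtain ⟨a', b', c', d', _, _, _, _, _, _, _, _, h'⟩ := exists_decomp ν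
  have key : ∀ (m : Measure G) [IsFiniteMeasure m], ∃ ρ ∈ M G, IsConv ρ (toComplex m) ν := by
    intro m _
    rw [h']
    exact exists_conv_add_right
      (exists_conv_add_right (exists_conv_toComplex m a')
        (exists_conv_neg_right (exists_conv_toComplex m b')))
      (exists_conv_I_smul_right (exists_conv_add_right (exists_conv_toComplex m c')
        (exists_conv_neg_right (exists_conv_toComplex m d'))))
  rw [h]
  exact exists_conv_add_left
    (exists_conv_add_left (key a) (exists_conv_neg_left (key b)))
    (exists_conv_I_smul_left (exists_conv_add_left (key c) (exists_conv_neg_left (key d))))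

/-- An element of `M G` is determined by its integrals against continuous compactly supported
functions; in particular, convolutions are unique. -/
theorem ext_of_cintegral {ρ ρ' : M G} (h : ∀ f : C_c(G, ℂ), cintegral ρ.1 f = cintegral ρ'.1 f) :
    ρ = ρ' := by
  rw [← sub_eq_zero]
  set σ : M G := ρ - ρ' with hσ
  have h0 : ∀ f : C_c(G, ℂ), cintegral σ.1 f = 0 := fun f ↦ by
    have : σ.1 = ρ.1 + -ρ'.1 := sub_eq_add_neg ρ.1 ρ'.1
    rw [this, cintegral_add f.integrable (VectorMeasure.Integrable.neg_vectorMeasure f.integrable),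
      cintegral_neg, h, add_neg_cancel]
  have hreg : σ.1.variation.Regular := σ.2
  obtain ⟨a, b, c, d, _, _, _, _, ha, hb, hc, hd, e⟩ := exists_decomp σ.1
  have := regular_of_le ha
  have := regular_of_le hb
  have := regular_of_le hc
  have := regular_of_le hd
  have key : ∀ f : C_c(G, ℝ), ∫ x, f x ∂a = ∫ x, f x ∂b ∧ ∫ x, f x ∂c = ∫ x, f x ∂d := by
    intro f
    let F : C_c(G, ℂ) := ⟨⟨fun x ↦ (f x : ℂ), by fun_prop⟩,
      f.hasCompactSupport.comp_left (g := Complex.ofReal) Complex.ofReal_zero⟩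
    have hF := h0 F
    rw [cintegral_congr_decomp e F.integrable F.integrable F.integrable F.integrable] at hF
    have hi : ∀ m : Measure G, ∫ x, F x ∂m = ((∫ x, f x ∂m : ℝ) : ℂ) :=
      fun m ↦ integral_complex_ofReal
    simp only [hi] at hF
    have h1 := congrArg Complex.re hF
    have h2 := congrArg Complex.im hF
    simp at h1 h2
    exact ⟨by linarith, by linarith⟩
  have hab : a = b := Measure.ext_of_integral_eq_on_compactlySupported fun f ↦ (key f).1
  have hcd : c = d := Measure.ext_of_integral_eq_on_compactlySupported fun f ↦ (key f).2
  subst hab hcd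
  refine Subtype.ext ?_
  rw [e]
  simp

/-- The convolution `μ ∗ ν` of two bounded regular complex measures: the bounded regular complex
measure with `∫ f d(μ ∗ ν) = ∫∫ f(xy) dμ(x) dν(y)` for all continuous compactly supported `f`. It
exists by `exists_conv` and is unique by `ext_of_cintegral`. -/
def conv (μ ν : M G) : M G :=
  ⟨(exists_conv μ.1 ν.1).choose, (exists_conv μ.1 ν.1).choose_spec.1⟩

theorem isConv_conv (μ ν : M G) : IsConv (conv μ ν).1 μ.1 ν.1 :=
  (exists_conv μ.1 ν.1).choose_spec.2

/-- `convPowSucc μ k` is the convolution power `μ ^ (k + 1)`. -/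
def convPowSucc (μ : M G) : ℕ → M G
  | 0 => μ
  | k + 1 => conv (convPowSucc μ k) μ

/-- The Cesàro averages `(μ + μ² + ⋯ + μⁿ) / n` (relevant for `n ≥ 1` only). -/
def cesaro (μ : M G) (n : ℕ) : M G :=
  (n : ℂ)⁻¹ • ∑ k ∈ Finset.range n, convPowSucc μ k

/-- The vague topology on `M G`: the weak topology induced by the functionals `μ ↦ ∫ f dμ`, where
`f` runs over the continuous functions vanishing at infinity. -/
@[reducible]
def vagueTopology (G : Type*) [TopologicalSpace G] [T2Space G] [MeasurableSpace G] [BorelSpace G] :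
    TopologicalSpace (M G) :=
  TopologicalSpace.induced (fun (μ : M G) (f : C₀(G, ℂ)) ↦ cintegral μ.1 f) inferInstance

/-- `μ` is vague-ergodic if its Cesàro averages converge in the vague topology to some element
of `M G`. -/
def IsVagueErgodic (μ : M G) : Prop :=
  ∃ μc : M G, Tendsto (cesaro μ) atTop (@nhds (M G) (vagueTopology G) μc)

end Convolution

end VagueErgodic

end

noncomputable section

namespace VagueErgodic

open MeasureTheory Filter Topology Set
open scoped ENNReal NNReal ZeroAtInfty CompactlySupported Pointwise

/-! ### Continuous functions vanishing at infinity -/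

section ZeroAtInfty

variable {X : Type*} [TopologicalSpace X]

/-! The Cesàro averages are bounded in norm, so along every ultrafilter they have a vague limit
(`exists_tendsto_pairing`). It remains to see that all limits at infinity coincide. Let `α` and `β`
be two of them. Since `μ^(n+1) - μ` stays bounded, its quotient by `n` tends to zero, and so `α ∗ μ
= α` and `μ ∗ β = β`. Hence `α ∗ μ^k = α` and `μ^k ∗ β = β` for all `k ≥ 1`. Averaging over `k` and
passing to the limit gives `α ∗ β = α` from the first identity and `α ∗ β = β` from the second.

These limits require convolution to be vaguely continuous in each factor separately. For this, `f ↦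
(y ↦ ∫ f(xy) dμ(x))` must map `C₀(G)` into itself (`IsProperKernel.exists_average`), and likewise
with the variables exchanged; convolution by a fixed measure is then the adjoint of such an
operator. Having both forms at once is a Fubini theorem (`IsProperKernel.pairing_average_swap`),
which for regular measures needs no countability assumption on `G`. -/

theorem norm_coe_le_norm (f : C₀(X, ℂ)) (x : X) : ‖f x‖ ≤ ‖f‖ := by
  rw [← ZeroAtInftyContinuousMap.norm_toBCF_eq_norm]
  exact f.toBCF.norm_coe_le_norm x

theorem norm_le_of_forall {f : C₀(X, ℂ)} {C : ℝ} (hC : 0 ≤ C) (h : ∀ x, ‖f x‖ ≤ C) : ‖f‖ ≤ C := by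
  rw [← ZeroAtInftyContinuousMap.norm_toBCF_eq_norm]
  exact (BoundedContinuousFunction.norm_le hC).2 h

/-- A compactly supported continuous function vanishes at infinity. -/
def ofCompactSupport (f : C_c(X, ℂ)) : C₀(X, ℂ) :=
  ⟨f.toContinuousMap, f.hasCompactSupport.is_zero_at_infty⟩

theorem exists_compactlySupported_near [T2Space X] [LocallyCompactSpace X] (f : C₀(X, ℂ)) {ε : ℝ}
    (hε : 0 < ε) : ∃ g : C_c(X, ℂ), ∀ x, ‖f x - g x‖ ≤ ε := by
  have h0 : ∀ᶠ x in cocompact X, ‖f x‖ < ε := by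
    have := (zero_at_infty f).norm
    rw [norm_zero] at this
    exact this.eventually (gt_mem_nhds hε)
  obtain ⟨K, hK, hKs⟩ := mem_cocompact.1 h0
  obtain ⟨φ, h1, -, hc, h01⟩ := exists_continuous_one_zero_of_isCompact hK
    (isClosed_empty (X := X)) (disjoint_empty K)
  -- The approximant is `f` times a cutoff equal to 1 on `K`; off `K` the error is at most `‖f x‖ <
  -- ε`.
  refine ⟨⟨⟨fun x ↦ (φ x : ℂ) * f x, by fun_prop⟩, ?_⟩, fun x ↦ ?_⟩
  · exact (hc.comp_left (g := Complex.ofReal) Complex.ofReal_zero).mul_right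
  · change ‖f x - (φ x : ℂ) * f x‖ ≤ ε
    by_cases hx : x ∈ K
    · have : φ x = 1 := h1 hx
      simp [this, hε.le]
    · have h2 : ‖f x‖ < ε := hKs hx
      have h3 : f x - (φ x : ℂ) * f x = ((1 - φ x : ℝ) : ℂ) * f x := by push_cast; ring
      rw [h3, norm_mul, Complex.norm_real, Real.norm_of_nonneg (by linarith [(h01 x).2])]
      nlinarith [(h01 x).1, norm_nonneg (f x)]

theorem denseRange_ofCompactSupport [T2Space X] [LocallyCompactSpace X] :
    DenseRange (ofCompactSupport (X := X)) := by
  refine Metric.denseRange_iff.2 fun f r hr ↦ ?_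
  obtain ⟨g, hg⟩ := exists_compactlySupported_near f (half_pos hr)
  refine ⟨g, lt_of_le_of_lt ?_ (half_lt_self hr)⟩
  rw [dist_eq_norm]
  exact norm_le_of_forall (half_pos hr).le fun x ↦ hg x

theorem continuous_and_zeroAtInfty_of_approx {F : X → ℂ}
    (h : ∀ ε > 0, ∃ g : C₀(X, ℂ), ∀ x, ‖F x - g x‖ ≤ ε) :
    ∃ F' : C₀(X, ℂ), ∀ x, F' x = F x := by
  refine ⟨⟨⟨F, ?_⟩, ?_⟩, fun x ↦ rfl⟩
  · refine continuous_of_uniform_approx_of_continuous fun u hu ↦ ?_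
    obtain ⟨ε, hε, hu⟩ := Metric.mem_uniformity_dist.1 hu
    obtain ⟨g, hg⟩ := h (ε / 2) (half_pos hε)
    refine ⟨g, map_continuous g, fun x ↦ hu ?_⟩
    rw [dist_eq_norm]
    exact (hg x).trans_lt (half_lt_self hε)
  · change Tendsto F (cocompact X) (𝓝 0)
    refine Metric.tendsto_nhds.2 fun ε hε ↦ ?_
    obtain ⟨g, hg⟩ := h (ε / 2) (half_pos hε)
    filter_upwards [Metric.tendsto_nhds.1 (zero_at_infty g) (ε / 2) (half_pos hε)] with x hx
    rw [dist_zero_right] at hx ⊢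
    have := norm_le_norm_sub_add (F x) (g x)
    linarith [hg x]

/-- By density, identities on `C₀` need only be checked on `C_c`, where convolution is defined and
Fubini is accessible. -/
theorem eq_of_eq_ofCompactSupport [T2Space X] [LocallyCompactSpace X] {φ ψ : C₀(X, ℂ) → ℂ}
    (hφ : Continuous φ) (hψ : Continuous ψ)
    (h : ∀ g, φ (ofCompactSupport g) = ψ (ofCompactSupport g)) (f : C₀(X, ℂ)) : φ f = ψ f :=
  congrFun (denseRange_ofCompactSupport.equalizer hφ hψ (funext h)) f

end ZeroAtInfty

/-! ### Integration of continuous functions vanishing at infinity -/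

section Pairing

variable {X : Type*} [MeasurableSpace X]

theorem norm_cintegral_le (μ : ComplexMeasure X) {f : X → ℂ} {C : ℝ} (hC : ∀ x, ‖f x‖ ≤ C) :
    ‖cintegral μ f‖ ≤ C * μ.variation.real univ := by
  have h := VectorMeasure.norm_integral_le_of_norm_le_const (μ := μ)
    (B := ContinuousLinearMap.mul ℝ ℂ) (ae_of_all _ hC)
  refine h.trans (le_of_eq ?_)
  rw [ContinuousLinearMap.opNorm_mul, mul_one]

theorem cintegral_ofReal_smul (μ : ComplexMeasure X) (c : ℝ) (f : X → ℂ) :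
    cintegral ((c : ℂ) • μ) f = c * cintegral μ f := by
  have h : ((c : ℂ) • μ) = c • μ := by
    ext s hs
    simp
  rw [h]
  exact (VectorMeasure.integral_smul_vectorMeasure f c).trans (Complex.real_smul)

variable [TopologicalSpace X] [BorelSpace X]

theorem integrable_of_norm_le (m : Measure X) [IsFiniteMeasure m] {f : X → ℂ} (hf : Continuous f)
    {C : ℝ} (hC : ∀ x, ‖f x‖ ≤ C) : Integrable f m :=
  Integrable.of_bound hf.aestronglyMeasurable C (ae_of_all _ hC)

theorem integrable_zeroAtInfty (m : Measure X) [IsFiniteMeasure m] (f : C₀(X, ℂ)) :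
    Integrable f m :=
  integrable_of_norm_le m (map_continuous f) (norm_coe_le_norm f)

/-- Splitting `c` into real and imaginary parts reduces this to real scalars and multiplication by
`I`. -/
theorem cintegral_smul (c : ℂ) (μ : ComplexMeasure X) (f : C₀(X, ℂ)) :
    cintegral (c • μ) f = c * cintegral μ f := by
  have h : c • μ = (c.re : ℂ) • μ + Complex.I • ((c.im : ℂ) • μ) := by
    ext s hs
    change c * μ s = c.re * μ s + Complex.I * (c.im * μ s)
    nth_rewrite 1 [← Complex.re_add_im c]
    ring
  rw [h, cintegral_add (integrable_zeroAtInfty _ f) (integrable_zeroAtInfty _ f),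
    cintegral_I_smul _ (integrable_zeroAtInfty _ f), cintegral_ofReal_smul, cintegral_ofReal_smul]
  nth_rewrite 3 [← Complex.re_add_im c]
  ring

/-- The functional on `C₀(X, ℂ)` given by integration against a complex measure. -/
def pairing : ComplexMeasure X →ₗ[ℂ] C₀(X, ℂ) →L[ℂ] ℂ where
  toFun μ := LinearMap.mkContinuous
    { toFun := fun f ↦ cintegral μ f
      map_add' := fun f g ↦ cintegral_fun_add (μ := μ) (integrable_zeroAtInfty _ f)
        (integrable_zeroAtInfty _ g)
      map_smul' := fun c f ↦ cintegral_const_mul μ c f }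
    (μ.variation.real univ) fun f ↦ by
      rw [mul_comm]
      exact norm_cintegral_le μ (norm_coe_le_norm f)
  map_add' μ ν := by
    ext f
    exact cintegral_add (integrable_zeroAtInfty _ f) (integrable_zeroAtInfty _ f)
  map_smul' c μ := by
    ext f
    exact cintegral_smul c μ f

theorem pairing_apply (μ : ComplexMeasure X) (f : C₀(X, ℂ)) : pairing μ f = cintegral μ f := rfl

theorem norm_pairing_le (μ : ComplexMeasure X) : ‖pairing μ‖ ≤ μ.variation.real univ :=
  ContinuousLinearMap.opNorm_le_bound _ measureReal_nonneg fun f ↦ by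
    rw [mul_comm]
    exact norm_cintegral_le μ (norm_coe_le_norm f)

/-- A property of bounded regular complex measures which holds for the positive ones and is
inherited by linear combinations holds for all of them. -/
theorem M.induction [T2Space X] {P : M X → Prop}
    (pos : ∀ (m : Measure X) [IsFiniteMeasure m] [m.Regular],
      P ⟨toComplex m, regular_of_le (variation_toComplex_le m)⟩)
    (add : ∀ μ ν, P μ → P ν → P (μ + ν)) (smul : ∀ (c : ℂ) μ, P μ → P (c • μ)) (μ : M X) :
    P μ := by
  have hreg : μ.1.variation.Regular := μ.2
  obtain ⟨a, b, c, d, _, _, _, _, ha, hb, hc, hd, e⟩ := exists_decomp μ.1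
  have := regular_of_le ha
  have := regular_of_le hb
  have := regular_of_le hc
  have := regular_of_le hd
  have h := add _ _ (add _ _ (pos a) (smul (-1) _ (pos b)))
    (smul Complex.I _ (add _ _ (pos c) (smul (-1) _ (pos d))))
  convert h using 1
  refine Subtype.ext (e.trans ?_)
  ext s hs
  change toComplex a s + -toComplex b s + Complex.I * (toComplex c s + -toComplex d s) =
    toComplex a s + -1 * toComplex b s + Complex.I * (toComplex c s + -1 * toComplex d s)
  ring

end Pairing

/-! ### Averaging a function over a proper family of maps -/

section Kernel

/-- A continuous binary operation `e` for which `e x y ∈ L` confines each of the variables `x`, `y`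
to a compact set as long as `L` is compact and the other variable stays in a compact set. -/
structure IsProperKernel {G : Type*} [TopologicalSpace G] (e : G → G → G) : Prop where
  continuous : Continuous fun p : G × G ↦ e p.1 p.2
  left : ∀ K L : Set G, IsCompact K → IsCompact L →
    ∃ K', IsCompact K' ∧ ∀ x y, y ∈ K → e x y ∈ L → x ∈ K'
  right : ∀ K L : Set G, IsCompact K → IsCompact L →
    ∃ K', IsCompact K' ∧ ∀ x y, x ∈ K → e x y ∈ L → y ∈ K'

theorem isProperKernel_mul {G : Type*} [Group G] [TopologicalSpace G] [IsTopologicalGroup G] :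
    IsProperKernel fun x y : G ↦ x * y where
  continuous := continuous_mul
  left K L hK hL := ⟨L * K⁻¹, hL.mul hK.inv, fun x y hy h ↦
    ⟨x * y, h, y⁻¹, by simpa using hy, by simp⟩⟩
  right K L hK hL := ⟨K⁻¹ * L, hK.inv.mul hL, fun x y hx h ↦
    ⟨x⁻¹, by simpa using hx, x * y, h, by simp⟩⟩

namespace IsProperKernel

variable {G : Type*} [TopologicalSpace G] {e : G → G → G}

/-- The conditions are symmetric, so every result on integration in `x` also yields its mirror image
in `y`. -/
theorem swap (he : IsProperKernel e) : IsProperKernel fun x y ↦ e y x where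
  continuous := he.continuous.comp continuous_swap
  left K L hK hL := by
    obtain ⟨K', hK', h⟩ := he.right K L hK hL
    exact ⟨K', hK', fun x y ↦ h y x⟩
  right K L hK hL := by
    obtain ⟨K', hK', h⟩ := he.left K L hK hL
    exact ⟨K', hK', fun x y ↦ h y x⟩

theorem continuous_left (he : IsProperKernel e) (y : G) : Continuous fun x ↦ e x y :=
  he.continuous.comp (continuous_id.prodMk continuous_const)

/-- The function `x ↦ f (e x y)`. -/
def slice (he : IsProperKernel e) (f : C₀(G, ℂ)) (y : G) : C₀(G, ℂ) where
  toFun x := f (e x y)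
  continuous_toFun := (map_continuous f).comp (he.continuous_left y)
  zero_at_infty' := by
    refine (zero_at_infty f).comp fun s hs ↦ ?_
    obtain ⟨L, hL, hLs⟩ := mem_cocompact.1 hs
    obtain ⟨K', hK', h⟩ := he.left {y} L isCompact_singleton hL
    refine mem_cocompact.2 ⟨K', hK', fun x hx ↦ hLs fun hxL ↦ hx ?_⟩
    exact h x y rfl hxL

@[simp]
theorem slice_apply (he : IsProperKernel e) (f : C₀(G, ℂ)) (x y : G) :
    he.slice f y x = f (e x y) := rfl

theorem norm_slice_le (he : IsProperKernel e) (f : C₀(G, ℂ)) (y : G) : ‖he.slice f y‖ ≤ ‖f‖ :=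
  norm_le_of_forall (norm_nonneg f) fun _ ↦ norm_coe_le_norm f _

variable [T2Space G] [LocallyCompactSpace G] [MeasurableSpace G] [BorelSpace G]

/-- Continuity is local: for `y` in a compact neighbourhood the integrands share a compact support.
For decay, regularity puts almost all of the mass of `m` on a compact `K`, and for `y` outside a
compact set the integrand vanishes on `K`. -/
theorem exists_integral (he : IsProperKernel e) (m : Measure G) [IsFiniteMeasure m] [m.Regular]
    (f : C_c(G, ℂ)) : ∃ F : C₀(G, ℂ), ∀ y, F y = ∫ x, f (e x y) ∂m := by
  refine ⟨⟨⟨fun y ↦ ∫ x, f (e x y) ∂m, ?_⟩, ?_⟩, fun y ↦ rfl⟩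
  · refine continuous_iff_continuousAt.2 fun y₀ ↦ ?_
    obtain ⟨t, t_comp, ht⟩ := exists_compact_mem_nhds y₀
    obtain ⟨K', hK', h⟩ := he.left t (tsupport f) t_comp f.hasCompactSupport
    have A : ContinuousOn (fun y : G ↦ ∫ x, f (e x y) ∂m) t := by
      refine continuousOn_integral_of_compact_support hK' ?_ ?_
      · exact (f.continuous.comp (he.continuous.comp continuous_swap)).continuousOn
      · intro y x hy hx
        contrapose! hx
        exact h x y hy (subset_tsupport _ hx)
    exact A.continuousAt ht
  · change Tendsto (fun y ↦ ∫ x, f (e x y) ∂m) (cocompact G) (𝓝 0)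
    refine Metric.tendsto_nhds.2 fun ε hε ↦ ?_
    have hC : ∀ x, ‖f x‖ ≤ ‖ofCompactSupport f‖ := norm_coe_le_norm (ofCompactSupport f)
    set C := ‖ofCompactSupport f‖
    have hC0 : 0 ≤ C := norm_nonneg _
    -- The `+ 1` covers the case `C = 0`.
    have hδ : 0 < ε / (C + 1) := by positivity
    obtain ⟨K, -, hK, hlt⟩ :=
      MeasurableSet.univ.exists_isCompact_sdiff_lt (measure_ne_top m univ)
      (ENNReal.ofReal_pos.2 hδ).ne'
    obtain ⟨K', hK', h⟩ := he.right K (tsupport f) hK f.hasCompactSupport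
    refine mem_cocompact.2 ⟨K', hK', fun y hy ↦ ?_⟩
    have h0 : ∀ x, x ∉ univ \ K → f (e x y) = 0 := fun x hx ↦ by
      by_contra hne
      exact hy (h x y (by simpa using hx) (subset_tsupport _ hne))
    have hm : m.real (univ \ K) < ε / (C + 1) := by
      rw [Measure.real]
      exact (ENNReal.lt_ofReal_iff_toReal_lt (measure_ne_top _ _)).1 hlt
    change dist (∫ x, f (e x y) ∂m) 0 < ε
    rw [dist_zero_right, ← setIntegral_eq_integral_of_forall_compl_eq_zero h0]
    calc ‖∫ x in univ \ K, f (e x y) ∂m‖ ≤ C * m.real (univ \ K) :=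
          norm_setIntegral_le_of_norm_le_const (measure_lt_top _ _) fun x _ ↦ hC _
      _ ≤ (C + 1) * m.real (univ \ K) := by gcongr; linarith
      _ < (C + 1) * (ε / (C + 1)) := by gcongr
      _ = ε := by field_simp

/-- For positive `μ` the average is a uniform limit of averages of compactly supported functions,
and `C₀` is closed under uniform limits; linearity in `μ` does the rest. -/
theorem exists_average (he : IsProperKernel e) (μ : M G) (f : C₀(G, ℂ)) :
    ∃ F : C₀(G, ℂ), ∀ y, F y = pairing μ.1 (he.slice f y) := by
  refine M.induction (P := fun μ ↦ ∀ f : C₀(G, ℂ), ∃ F : C₀(G, ℂ),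
    ∀ y, F y = pairing μ.1 (he.slice f y)) (fun m _ _ f ↦ ?_) (fun μ ν h1 h2 f ↦ ?_)
    (fun c μ h f ↦ ?_) μ f
  · refine continuous_and_zeroAtInfty_of_approx fun ε hε ↦ ?_
    have hδ : 0 < ε / (m.real univ + 1) := by positivity
    obtain ⟨g, hg⟩ := exists_compactlySupported_near f hδ
    obtain ⟨F, hF⟩ := he.exists_integral m g
    refine ⟨F, fun y ↦ ?_⟩
    have h1 : F y = ∫ x, he.slice (ofCompactSupport g) y x ∂m := hF y
    rw [h1, pairing_apply, cintegral_toComplex,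
      ← integral_sub (integrable_zeroAtInfty _ _) (integrable_zeroAtInfty _ _)]
    calc _ ≤ ε / (m.real univ + 1) * m.real univ :=
          norm_integral_le_of_norm_le_const (ae_of_all _ fun x ↦ hg _)
      _ ≤ ε / (m.real univ + 1) * (m.real univ + 1) := by gcongr; linarith
      _ = ε := by field_simp
  · obtain ⟨F, hF⟩ := h1 f
    obtain ⟨F', hF'⟩ := h2 f
    exact ⟨F + F', fun y ↦ by simp [hF, hF']⟩
  · obtain ⟨F, hF⟩ := h f
    exact ⟨c • F, fun y ↦ by simp [hF]⟩

/-- The operator `f ↦ (y ↦ ∫ f (e x y) dμ(x))` on `C₀(G, ℂ)`. -/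
def average (he : IsProperKernel e) (μ : M G) : C₀(G, ℂ) →L[ℂ] C₀(G, ℂ) :=
  LinearMap.mkContinuous
    { toFun := fun f ↦ (he.exists_average μ f).choose
      map_add' := fun f g ↦ by
        ext y
        rw [ZeroAtInftyContinuousMap.add_apply]
        simp only [(he.exists_average μ _).choose_spec]
        rw [← map_add]
        rfl
      map_smul' := fun c f ↦ by
        ext y
        rw [ZeroAtInftyContinuousMap.smul_apply]
        simp only [(he.exists_average μ _).choose_spec]
        rw [RingHom.id_apply, ← map_smul]
        rfl }
    ‖pairing μ.1‖ fun f ↦ by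
      refine norm_le_of_forall (by positivity) fun y ↦ ?_
      change ‖(he.exists_average μ f).choose y‖ ≤ _
      rw [(he.exists_average μ f).choose_spec]
      exact ((pairing μ.1).le_opNorm _).trans (by gcongr; exact he.norm_slice_le f y)

theorem average_apply (he : IsProperKernel e) (μ : M G) (f : C₀(G, ℂ)) (y : G) :
    he.average μ f y = pairing μ.1 (he.slice f y) :=
  (he.exists_average μ f).choose_spec y

attribute [irreducible] average

theorem average_ofCompactSupport (he : IsProperKernel e) (μ : M G) (g : C_c(G, ℂ)) (y : G) :
    he.average μ (ofCompactSupport g) y = cintegral μ.1 fun x ↦ g (e x y) :=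
  he.average_apply μ _ y

theorem average_add (he : IsProperKernel e) (μ ν : M G) :
    he.average (μ + ν) = he.average μ + he.average ν := by
  ext f y
  simp [average_apply]

theorem average_smul (he : IsProperKernel e) (c : ℂ) (μ : M G) :
    he.average (c • μ) = c • he.average μ := by
  ext f y
  simp [average_apply]

end IsProperKernel

end Kernel

/-! ### Interchanging the order of integration -/

section Fubini

namespace IsProperKernel

variable {G : Type*} [TopologicalSpace G] {e : G → G → G} [T2Space G] [LocallyCompactSpace G]
  [MeasurableSpace G] [BorelSpace G]

/-- A cutoff `φ` in `x`, equal to 1 on `K`, changes neither side. By properness `φ x * f (e x y)`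
has compact support in both variables jointly, and for such continuous functions Fubini holds
without σ-finiteness or countability conditions. -/
theorem setIntegral_swap (he : IsProperKernel e) (m n : Measure G) [IsFiniteMeasure m]
    [IsFiniteMeasure n] {K : Set G} (hK : IsCompact K) (f : C_c(G, ℂ)) :
    ∫ y, ∫ x in K, f (e x y) ∂m ∂n = ∫ x in K, ∫ y, f (e x y) ∂n ∂m := by
  obtain ⟨φ, h1, -, hc, -⟩ := exists_continuous_one_zero_of_isCompact hK
    (isClosed_empty (X := G)) (disjoint_empty K)
  have e1 : ∀ y, ∫ x in K, f (e x y) ∂m = ∫ x in K, (φ x : ℂ) * f (e x y) ∂m := fun y ↦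
    setIntegral_congr_fun hK.measurableSet fun x hx ↦ by
      have : φ x = 1 := h1 hx
      simp [this]
  have e2 : ∫ x in K, ∫ y, f (e x y) ∂n ∂m = ∫ x in K, ∫ y, (φ x : ℂ) * f (e x y) ∂n ∂m :=
    setIntegral_congr_fun hK.measurableSet fun x hx ↦ by
      have : φ x = 1 := h1 hx
      simp [this]
  rw [e2]
  simp only [e1]
  obtain ⟨K', hK', h⟩ := he.right (tsupport φ) (tsupport f) hc f.hasCompactSupport
  refine integral_integral_swap_of_hasCompactSupport (f := fun y x ↦ (φ x : ℂ) * f (e x y)) ?_ ?_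
  · exact (Complex.continuous_ofReal.comp (φ.continuous.comp continuous_snd)).mul
      (f.continuous.comp (he.continuous.comp continuous_swap))
  · refine HasCompactSupport.intro (hK'.prod hc) fun p hp ↦ ?_
    change (φ p.2 : ℂ) * f (e p.2 p.1) = 0
    by_contra hne
    have hφ : p.2 ∈ tsupport φ := subset_tsupport _ fun h0 ↦ hne (by simp [h0])
    have hf : e p.2 p.1 ∈ tsupport f := subset_tsupport _ (right_ne_zero_of_mul hne)
    exact hp ⟨h _ _ hφ hf, hφ⟩

/-- Regularity of `m` gives a compact `K` with `m Kᶜ` small. The parts over `K` agree by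
`setIntegral_swap`, and each of the two parts over `Kᶜ` is at most `D * m Kᶜ`. -/
theorem integral_swap (he : IsProperKernel e) (m n : Measure G) [IsFiniteMeasure m]
    [IsFiniteMeasure n] [m.Regular] [n.Regular] (f : C_c(G, ℂ)) :
    ∫ y, ∫ x, f (e x y) ∂m ∂n = ∫ x, ∫ y, f (e x y) ∂n ∂m := by
  have hC : ∀ x, ‖f x‖ ≤ ‖ofCompactSupport f‖ := norm_coe_le_norm (ofCompactSupport f)
  set C := ‖ofCompactSupport f‖
  have hC0 : 0 ≤ C := norm_nonneg _
  set D := C * n.real univ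
  have hD0 : 0 ≤ D := by positivity
  refine eq_of_forall_dist_le fun ε hε ↦ ?_
  have hδ : 0 < ε / (2 * D + 1) := by positivity
  obtain ⟨K, -, hK, hlt⟩ := MeasurableSet.univ.exists_isCompact_sdiff_lt (measure_ne_top m univ)
    (ENNReal.ofReal_pos.2 hδ).ne'
  rw [← compl_eq_univ_sdiff] at hlt
  have hm : m.real Kᶜ < ε / (2 * D + 1) :=
    (ENNReal.lt_ofReal_iff_toReal_lt (measure_ne_top _ _)).1 hlt
  have hint : ∀ s : Set G, Integrable (fun y ↦ ∫ x in s, f (e x y) ∂m) n := fun s ↦ by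
    have : (m.restrict s).Regular := regular_of_le Measure.restrict_le_self
    obtain ⟨F, hF⟩ := he.exists_integral (m.restrict s) f
    exact (integrable_zeroAtInfty n F).congr (ae_of_all _ hF)
  have hint' : Integrable (fun x ↦ ∫ y, f (e x y) ∂n) m := by
    obtain ⟨F, hF⟩ := he.swap.exists_integral n f
    exact (integrable_zeroAtInfty m F).congr (ae_of_all _ hF)
  have hl : ∫ y, ∫ x, f (e x y) ∂m ∂n =
      ∫ y, ∫ x in K, f (e x y) ∂m ∂n + ∫ y, ∫ x in Kᶜ, f (e x y) ∂m ∂n := by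
    rw [← integral_add (hint K) (hint Kᶜ)]
    refine integral_congr_ae (ae_of_all _ fun y ↦ ?_)
    refine (integral_add_compl hK.measurableSet ?_).symm
    exact integrable_of_norm_le m (f.continuous.comp (he.continuous_left y)) fun x ↦ hC _
  have hb1 : ‖∫ y, ∫ x in Kᶜ, f (e x y) ∂m ∂n‖ ≤ C * m.real Kᶜ * n.real univ :=
    norm_integral_le_of_norm_le_const (ae_of_all _ fun y ↦
      norm_setIntegral_le_of_norm_le_const (measure_lt_top _ _) fun x _ ↦ hC _)
  have hb2 : ‖∫ x in Kᶜ, ∫ y, f (e x y) ∂n ∂m‖ ≤ D * m.real Kᶜ :=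
    norm_setIntegral_le_of_norm_le_const (measure_lt_top _ _) fun x _ ↦
      norm_integral_le_of_norm_le_const (ae_of_all _ fun y ↦ hC _)
  rw [hl, ← integral_add_compl hK.measurableSet hint', he.setIntegral_swap m n hK, dist_eq_norm,
    add_sub_add_left_eq_sub]
  calc _ ≤ C * m.real Kᶜ * n.real univ + D * m.real Kᶜ :=
        (norm_sub_le _ _).trans (add_le_add hb1 hb2)
    _ = 2 * D * m.real Kᶜ := by ring
    _ ≤ (2 * D + 1) * m.real Kᶜ := by gcongr; linarith
    _ ≤ (2 * D + 1) * (ε / (2 * D + 1)) := by gcongr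
    _ = ε := by field_simp

/-- Fubini for complex measures: bilinearity reduces to positive measures, density to compactly
supported `f`. -/
theorem pairing_average_swap (he : IsProperKernel e) (μ ν : M G) (f : C₀(G, ℂ)) :
    pairing ν.1 (he.average μ f) = pairing μ.1 (he.swap.average ν f) := by
  have key : ∀ (m n : Measure G) [IsFiniteMeasure m] [IsFiniteMeasure n] (hm : m.Regular)
      (hn : n.Regular) (f : C₀(G, ℂ)), pairing (toComplex n) (he.average
        ⟨toComplex m, regular_of_le (variation_toComplex_le m)⟩ f) = pairing (toComplex m)
        (he.swap.average ⟨toComplex n, regular_of_le (variation_toComplex_le n)⟩ f) := by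
    intro m n _ _ _ _ f
    refine eq_of_eq_ofCompactSupport
      (φ := fun f ↦ pairing (toComplex n) (he.average _ f))
      (ψ := fun f ↦ pairing (toComplex m) (he.swap.average _ f))
      ((pairing _).continuous.comp (he.average _).continuous)
      ((pairing _).continuous.comp (he.swap.average _).continuous) (fun g ↦ ?_) f
    rw [pairing_apply, pairing_apply, cintegral_toComplex, cintegral_toComplex]
    simp only [average_ofCompactSupport, cintegral_toComplex]
    exact he.integral_swap m n g
  induction μ using M.induction with
  | pos m =>
    induction ν using M.induction with
    | pos n => exact key m n inferInstance inferInstance f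
    | add ν ν' h h' =>
      rw [average_add, add_apply, map_add, ← h, ← h', Submodule.coe_add, map_add,
        add_apply]
    | smul c ν h =>
      rw [average_smul, smul_apply, map_smul, ← h, Submodule.coe_smul, map_smul,
        smul_apply]
  | add μ μ' h h' =>
    rw [average_add, add_apply, map_add, h, h', Submodule.coe_add, map_add,
      add_apply]
  | smul c μ h =>
    rw [average_smul, smul_apply, map_smul, h, Submodule.coe_smul, map_smul,
      smul_apply]

end IsProperKernel

end Fubini

/-! ### The convolution algebra -/

section ConvolutionAlgebra

variable {G : Type*} [Group G] [TopologicalSpace G] [IsTopologicalGroup G]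
    [LocallyCompactSpace G] [T2Space G] [MeasurableSpace G] [BorelSpace G]

theorem ext_of_pairing {μ ν : M G} (h : ∀ f, pairing μ.1 f = pairing ν.1 f) : μ = ν :=
  ext_of_cintegral fun f ↦ h (ofCompactSupport f)

/-- Exhibits `ν ↦ μ ∗ ν` as the adjoint of an operator on `C₀(G)`, hence as vaguely continuous. The
mirror form `pairing_conv_swap` does the same for the first factor. -/
theorem pairing_conv (μ ν : M G) (f : C₀(G, ℂ)) :
    pairing (conv μ ν).1 f = pairing ν.1 (isProperKernel_mul.average μ f) := by
  refine eq_of_eq_ofCompactSupport (φ := fun f ↦ pairing (conv μ ν).1 f)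
    (ψ := fun f ↦ pairing ν.1 (isProperKernel_mul.average μ f)) (pairing _).continuous
    ((pairing _).continuous.comp (isProperKernel_mul.average _).continuous) (fun g ↦ ?_) f
  rw [pairing_apply, pairing_apply]
  refine (isConv_conv μ ν g).trans (congrArg (cintegral ν.1) (funext fun y ↦ ?_))
  rw [IsProperKernel.average_ofCompactSupport]

theorem pairing_conv_swap (μ ν : M G) (f : C₀(G, ℂ)) :
    pairing (conv μ ν).1 f = pairing μ.1 (isProperKernel_mul.swap.average ν f) := by
  rw [pairing_conv, IsProperKernel.pairing_average_swap]

/-- Both sides unfold to the integral of `f(xyz)` in the same order of integration, so no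
interchange is needed. -/
theorem conv_assoc (μ ν ρ : M G) : conv (conv μ ν) ρ = conv μ (conv ν ρ) := by
  refine ext_of_pairing fun f ↦ ?_
  rw [pairing_conv, pairing_conv, pairing_conv]
  refine congrArg (pairing ρ.1) (ZeroAtInftyContinuousMap.ext fun z ↦ ?_)
  rw [IsProperKernel.average_apply, IsProperKernel.average_apply, pairing_conv]
  refine congrArg (pairing ν.1) (ZeroAtInftyContinuousMap.ext fun y ↦ ?_)
  rw [IsProperKernel.slice_apply, IsProperKernel.average_apply, IsProperKernel.average_apply]
  refine congrArg (pairing μ.1) (ZeroAtInftyContinuousMap.ext fun x ↦ ?_)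
  simp [mul_assoc]

theorem conv_convPowSucc (μ : M G) (k : ℕ) :
    conv μ (convPowSucc μ k) = convPowSucc μ (k + 1) := by
  induction k with
  | zero => rfl
  | succ k ih =>
    change conv μ (conv (convPowSucc μ k) μ) = conv (convPowSucc μ (k + 1)) μ
    rw [← conv_assoc, ih]

theorem conv_convPowSucc_of_conv_eq {μ α : M G} (h : conv α μ = α) (k : ℕ) :
    conv α (convPowSucc μ k) = α := by
  induction k with
  | zero => exact h
  | succ k ih =>
    change conv α (conv (convPowSucc μ k) μ) = α
    rw [← conv_assoc, ih, h]

theorem convPowSucc_conv_of_conv_eq {μ β : M G} (h : conv μ β = β) (k : ℕ) :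
    conv (convPowSucc μ k) β = β := by
  induction k with
  | zero => exact h
  | succ k ih =>
    change conv (conv (convPowSucc μ k) μ) β = β
    rw [conv_assoc, h, ih]

end ConvolutionAlgebra

/-! ### Vague compactness of bounded families -/

section Compactness

variable {X : Type*} [MeasurableSpace X]

theorem norm_nonneg_M [TopologicalSpace X] [T2Space X] [BorelSpace X] (μ : M X) : 0 ≤ ‖μ‖ :=
  ENNReal.toReal_nonneg

theorem norm_zero_M [TopologicalSpace X] [T2Space X] [BorelSpace X] : ‖(0 : M X)‖ = 0 := by
  change ((0 : ComplexMeasure X).variation univ).toReal = 0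
  simp

theorem norm_add_le_M [TopologicalSpace X] [T2Space X] [BorelSpace X] (μ ν : M X) :
    ‖μ + ν‖ ≤ ‖μ‖ + ‖ν‖ := by
  change ((μ.1 + ν.1).variation univ).toReal
    ≤ (μ.1.variation univ).toReal + (ν.1.variation univ).toReal
  rw [← ENNReal.toReal_add (measure_ne_top _ _) (measure_ne_top _ _)]
  exact ENNReal.toReal_mono (by finiteness) (VectorMeasure.variation_add_le univ)

theorem norm_smul_M [TopologicalSpace X] [T2Space X] [BorelSpace X] (c : ℂ) (μ : M X) :
    ‖c • μ‖ = ‖c‖ * ‖μ‖ := by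
  change ((c • μ.1).variation univ).toReal = ‖c‖ * (μ.1.variation univ).toReal
  rw [VectorMeasure.variation_smul]
  simp

theorem norm_sum_le_M [TopologicalSpace X] [T2Space X] [BorelSpace X] {ι : Type*} (s : Finset ι)
    {ν : ι → M X} {C : ℝ} (h : ∀ i, ‖ν i‖ ≤ C) : ‖∑ i ∈ s, ν i‖ ≤ s.card * C := by
  classical
  induction s using Finset.induction_on with
  | empty => simp [norm_zero_M]
  | insert a s ha ih =>
    rw [Finset.sum_insert ha, Finset.card_insert_of_notMem ha]
    push_cast
    linarith [norm_add_le_M (ν a) (∑ i ∈ s, ν i), h a]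

/-- An `ε/3` argument: equibounded functionals converge everywhere once they converge on a dense
set. -/
theorem tendsto_of_dense {E ι α : Type*} [NormedAddCommGroup E] [NormedSpace ℂ E] {l : Filter ι}
    {φ : ι → E →L[ℂ] ℂ} {ψ : E →L[ℂ] ℂ} {C : ℝ} (hφ : ∀ i, ‖φ i‖ ≤ C) {d : α → E}
    (hd : DenseRange d) (h : ∀ a, Tendsto (fun i ↦ φ i (d a)) l (𝓝 (ψ (d a)))) (f : E) :
    Tendsto (fun i ↦ φ i f) l (𝓝 (ψ f)) := by
  refine Metric.tendsto_nhds.2 fun ε hε ↦ ?_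
  set B := max C ‖ψ‖
  have hB : 0 ≤ B := (norm_nonneg ψ).trans (le_max_right _ _)
  have hδ : 0 < ε / (3 * (B + 1)) := by positivity
  obtain ⟨a, ha⟩ := Metric.denseRange_iff.1 hd f _ hδ
  rw [dist_eq_norm] at ha
  have key : ∀ χ : E →L[ℂ] ℂ, ‖χ‖ ≤ B → ‖χ f - χ (d a)‖ ≤ ε / 3 := fun χ hχ ↦ by
    rw [← map_sub]
    calc ‖χ (f - d a)‖ ≤ ‖χ‖ * ‖f - d a‖ := χ.le_opNorm _
      _ ≤ (B + 1) * (ε / (3 * (B + 1))) := by gcongr; linarith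
      _ = ε / 3 := by field_simp
  filter_upwards [Metric.tendsto_nhds.1 (h a) (ε / 3) (by positivity)] with i hi
  rw [dist_eq_norm] at hi ⊢
  have h1 := key (φ i) ((hφ i).trans (le_max_left _ _))
  have h2 := key ψ (le_max_right _ _)
  have e : φ i f - ψ f = (φ i f - φ i (d a)) + (φ i (d a) - ψ (d a)) - (ψ f - ψ (d a)) := by ring
  rw [e]
  calc _ ≤ ‖φ i f - φ i (d a)‖ + ‖φ i (d a) - ψ (d a)‖ + ‖ψ f - ψ (d a)‖ :=
        (norm_sub_le _ _).trans (by gcongr; exact norm_add_le _ _)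
    _ < ε := by linarith

variable [TopologicalSpace X] [T2Space X] [LocallyCompactSpace X] [BorelSpace X] {ι : Type*}

/-- For each `f` the integrals stay in a compact ball, so they converge along `U`. The limit is a
positive functional of `f`, to which the Riesz theorem applies. -/
theorem exists_tendsto_integral (U : Ultrafilter ι) (m : ι → Measure X)
    [∀ i, IsFiniteMeasure (m i)] {C : ℝ} (hC : ∀ i, (m i).real univ ≤ C) :
    ∃ (ρ : Measure X) (_ : IsFiniteMeasure ρ) (_ : ρ.Regular),
      ∀ f : C_c(X, ℝ), Tendsto (fun i ↦ ∫ x, f x ∂m i) U (𝓝 (∫ x, f x ∂ρ)) := by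
  have hb : ∀ (f : C_c(X, ℝ)) (B : ℝ), 0 ≤ B → (∀ x, ‖f x‖ ≤ B) →
      ∀ i, ‖∫ x, f x ∂m i‖ ≤ B * C := fun f B hB h i ↦
    (norm_integral_le_of_norm_le_const (ae_of_all _ h)).trans (by gcongr; exact hC i)
  have hlim : ∀ f : C_c(X, ℝ), ∃ L, Tendsto (fun i ↦ ∫ x, f x ∂m i) U (𝓝 L) := fun f ↦ by
    obtain ⟨B, hB⟩ := f.hasCompactSupport.exists_bound_of_continuous f.continuous
    have hB' : ∀ x, ‖f x‖ ≤ max B 0 := fun x ↦ (hB x).trans (le_max_left _ _)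
    obtain ⟨L, -, hL⟩ := (isCompact_closedBall (0 : ℝ) (max B 0 * C)).ultrafilter_le_nhds
      (U.map fun i ↦ ∫ x, f x ∂m i) (by
        rw [le_principal_iff]
        exact Filter.mem_map.2 (Eventually.of_forall fun i ↦ by
          simpa using hb f _ (le_max_right _ _) hB' i))
    exact ⟨L, hL⟩
  choose L hL using hlim
  let Λ : C_c(X, ℝ) →ₚ[ℝ] ℝ := PositiveLinearMap.mk₀
    { toFun := L
      map_add' := fun f g ↦ tendsto_nhds_unique (hL (f + g)) <| by
        refine ((hL f).add (hL g)).congr fun i ↦ ?_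
        exact (integral_add f.integrable g.integrable).symm
      map_smul' := fun c f ↦ tendsto_nhds_unique (hL (c • f)) <| by
        refine ((hL f).const_mul c).congr fun i ↦ ?_
        exact (integral_const_mul c f).symm }
    fun f hf ↦ ge_of_tendsto' (hL f) fun i ↦ integral_nonneg fun x ↦ hf x
  have hΛ : ∀ f : C_c(X, ℝ), Λ f = L f := fun f ↦ rfl
  refine ⟨RealRMK.rieszMeasure Λ, ⟨?_⟩, inferInstance, fun f ↦ ?_⟩
  -- Finiteness: testing on a cutoff with values in `[0, 1]` bounds the mass of each compact set by
  -- `C`, hence the total mass by inner regularity.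
  · have hK : ∀ K : Set X, IsCompact K →
        RealRMK.rieszMeasure Λ K ≤ ENNReal.ofReal (1 * C) := by
      intro K hK
      obtain ⟨f, h1, -, hc, h01⟩ := exists_continuous_one_zero_of_isCompact hK
        (isClosed_empty (X := X)) (disjoint_empty K)
      let g : C_c(X, ℝ) := ⟨f, hc⟩
      refine (RealRMK.rieszMeasure_le_of_eq_one Λ (f := g) (fun x ↦ (h01 x).1) hK
        (fun x hx ↦ h1 hx)).trans (ENNReal.ofReal_le_ofReal ?_)
      rw [hΛ]
      refine le_of_tendsto' (hL g) fun i ↦ (le_abs_self _).trans (hb g 1 zero_le_one (fun x ↦ ?_) i)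
      change ‖f x‖ ≤ 1
      rw [Real.norm_of_nonneg (h01 _).1]
      exact (h01 _).2
    rw [isOpen_univ.measure_eq_iSup_isCompact]
    exact (iSup₂_le fun K _ ↦ iSup_le fun hc ↦ hK K hc).trans_lt ENNReal.ofReal_lt_top
  · rw [RealRMK.integral_rieszMeasure, hΛ]
    exact hL f

theorem exists_tendsto_pairing_toComplex (U : Ultrafilter ι) (m : ι → Measure X)
    [∀ i, IsFiniteMeasure (m i)] {C : ℝ} (hC : ∀ i, (m i).real univ ≤ C) :
    ∃ ρ : M X, ∀ f, Tendsto (fun i ↦ pairing (toComplex (m i)) f) U (𝓝 (pairing ρ.1 f)) := by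
  obtain ⟨ρ, _, _, h⟩ := exists_tendsto_integral U m hC
  refine ⟨⟨toComplex ρ, regular_of_le (variation_toComplex_le ρ)⟩, fun f ↦ ?_⟩
  refine tendsto_of_dense (C := C) (fun i ↦ ?_) denseRange_ofCompactSupport (fun g ↦ ?_) f
  · refine (norm_pairing_le _).trans (le_trans ?_ (hC i))
    exact ENNReal.toReal_mono (measure_ne_top _ _) (variation_toComplex_le (m i) univ)
  · simp only [pairing_apply, cintegral_toComplex]
    let u : C_c(X, ℝ) := ⟨⟨fun x ↦ (g x).re, by fun_prop⟩,
      g.hasCompactSupport.comp_left (g := Complex.re) Complex.zero_re⟩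
    let v : C_c(X, ℝ) := ⟨⟨fun x ↦ (g x).im, by fun_prop⟩,
      g.hasCompactSupport.comp_left (g := Complex.im) Complex.zero_im⟩
    have hg : ∀ (n : Measure X) [IsFiniteMeasure n], ∫ x, ofCompactSupport g x ∂n
        = ((∫ x, u x ∂n : ℝ) : ℂ) + ((∫ x, v x ∂n : ℝ) : ℂ) * Complex.I := fun n _ ↦
      (integral_re_add_im (𝕜 := ℂ) (integrable_zeroAtInfty n (ofCompactSupport g))).symm
    simp only [hg]
    exact ((Complex.continuous_ofReal.tendsto _).comp (h u)).add
      (((Complex.continuous_ofReal.tendsto _).comp (h v)).mul_const _)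

/-- Each `ν i` splits into four positive measures dominated by its variation, so of mass at most
`C`; their limits are taken separately. -/
theorem exists_tendsto_pairing (U : Ultrafilter ι) (ν : ι → M X) {C : ℝ} (hC : ∀ i, ‖ν i‖ ≤ C) :
    ∃ ρ : M X, ∀ f, Tendsto (fun i ↦ pairing (ν i).1 f) U (𝓝 (pairing ρ.1 f)) := by
  choose a b c d _ _ _ _ ha hb hc hd e using fun i ↦ exists_decomp (ν i).1
  have key : ∀ m : ι → Measure X, (∀ i, m i ≤ (ν i).1.variation) → ∀ i, (m i).real univ ≤ C :=
    fun m hm i ↦ (ENNReal.toReal_mono (measure_ne_top _ _) (hm i univ)).trans (hC i)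
  obtain ⟨ρa, hρa⟩ := exists_tendsto_pairing_toComplex U a (key a ha)
  obtain ⟨ρb, hρb⟩ := exists_tendsto_pairing_toComplex U b (key b hb)
  obtain ⟨ρc, hρc⟩ := exists_tendsto_pairing_toComplex U c (key c hc)
  obtain ⟨ρd, hρd⟩ := exists_tendsto_pairing_toComplex U d (key d hd)
  refine ⟨(ρa + -ρb) + Complex.I • (ρc + -ρd), fun f ↦ ?_⟩
  have h := ((hρa f).add (hρb f).neg).add (((hρc f).add (hρd f).neg).const_mul Complex.I)
  simp only [mul_add, mul_neg] at h
  convert h using 2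
  · rw [e]
    simp
  · simp

end Compactness

/-! ### Convergence of the Cesàro averages -/

section Ergodic

variable {G : Type*} [Group G] [TopologicalSpace G] [IsTopologicalGroup G]
    [LocallyCompactSpace G] [T2Space G] [MeasurableSpace G] [BorelSpace G]

theorem pairing_cesaro (μ : M G) (n : ℕ) (f : C₀(G, ℂ)) :
    pairing (cesaro μ n).1 f = (n : ℂ)⁻¹ * ∑ k ∈ Finset.range n, pairing (convPowSucc μ k).1 f := by
  simp [cesaro]

theorem norm_cesaro_le {μ : M G} {C : ℝ} (hC : ∀ k, ‖convPowSucc μ k‖ ≤ C) (n : ℕ) :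
    ‖cesaro μ n‖ ≤ C := by
  have hC0 : 0 ≤ C := (norm_nonneg_M _).trans (hC 0)
  rw [cesaro, norm_smul_M, norm_inv, Complex.norm_natCast]
  rcases Nat.eq_zero_or_pos n with rfl | hn
  · simpa using hC0
  · have h := norm_sum_le_M (Finset.range n) hC
    rw [Finset.card_range] at h
    rwa [inv_mul_le_iff₀ (by positivity)]

/-- The pairing of a limit of the Cesàro averages with a function on which all the powers take the
same value. -/
theorem pairing_eq_of_forall_pow {μ α : M G} {l : Filter ℕ} [l.NeBot] (hl : l ≤ atTop)
    {f : C₀(G, ℂ)} {c : ℂ} (h : Tendsto (fun n ↦ pairing (cesaro μ n).1 f) l (𝓝 (pairing α.1 f)))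
    (hc : ∀ k, pairing (convPowSucc μ k).1 f = c) : pairing α.1 f = c := by
  refine tendsto_nhds_unique h (tendsto_const_nhds.congr' (hl ?_))
  -- The average of index 0 is zero, not `c`.
  filter_upwards [eventually_ne_atTop 0] with n hn
  have : (n : ℂ) ≠ 0 := by exact_mod_cast hn
  simp [pairing_cesaro, hc, this]

/-- A limit of the Cesàro averages takes the same value on `f` and `g` if `g` is a shift of `f` along
the powers. -/
theorem pairing_eq_of_shift {μ α : M G} {C : ℝ} (hC : ∀ k, ‖convPowSucc μ k‖ ≤ C) {l : Filter ℕ}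
    [l.NeBot] (hl : l ≤ atTop)
    (h : ∀ f, Tendsto (fun n ↦ pairing (cesaro μ n).1 f) l (𝓝 (pairing α.1 f))) {f g : C₀(G, ℂ)}
    (hfg : ∀ k, pairing (convPowSucc μ k).1 g = pairing (convPowSucc μ (k + 1)).1 f) :
    pairing α.1 g = pairing α.1 f := by
  have hb : ∀ k, ‖pairing (convPowSucc μ k).1 f‖ ≤ C * ‖f‖ := fun k ↦
    ((pairing _).le_opNorm f).trans (by gcongr; exact (norm_pairing_le _).trans (hC k))
  have h0 : Tendsto (fun n ↦ pairing (cesaro μ n).1 g - pairing (cesaro μ n).1 f) atTop (𝓝 0) := by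
    refine squeeze_zero_norm (a := fun n : ℕ ↦ (n : ℝ)⁻¹ * (C * ‖f‖ + C * ‖f‖)) (fun n ↦ ?_) ?_
    · rw [pairing_cesaro, pairing_cesaro, ← mul_sub, ← Finset.sum_sub_distrib]
      simp only [hfg]
      -- The sum telescopes to `μ^(n+1) - μ` evaluated at `f`.
      rw [Finset.sum_range_sub (fun k ↦ pairing (convPowSucc μ k).1 f), norm_mul, norm_inv,
        Complex.norm_natCast]
      gcongr
      exact (norm_sub_le _ _).trans (add_le_add (hb n) (hb 0))
    · simpa using tendsto_inv_atTop_nhds_zero_nat.mul_const (C * ‖f‖ + C * ‖f‖)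
  exact sub_eq_zero.1 (tendsto_nhds_unique ((h g).sub (h f)) (h0.mono_left hl))

/-- If `α` and `β` are vague limits of the Cesàro averages of `μ` along two filters, then
`α = α ∗ β = β`. -/
theorem cesaro_limit_unique {μ α β : M G} {C : ℝ} (hC : ∀ k, ‖convPowSucc μ k‖ ≤ C)
    {l l' : Filter ℕ} [l.NeBot] [l'.NeBot] (hl : l ≤ atTop) (hl' : l' ≤ atTop)
    (hα : ∀ f, Tendsto (fun n ↦ pairing (cesaro μ n).1 f) l (𝓝 (pairing α.1 f)))
    (hβ : ∀ f, Tendsto (fun n ↦ pairing (cesaro μ n).1 f) l' (𝓝 (pairing β.1 f))) : α = β := by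
  -- Integrating `f` against `α ∗ μ` is integrating its average under `μ` against `α`, and that
  -- average shifts the powers by one.
  have h1 : conv α μ = α := ext_of_pairing fun f ↦ by
    rw [pairing_conv_swap]
    refine pairing_eq_of_shift hC hl hα fun k ↦ ?_
    rw [← pairing_conv_swap]
    rfl
  have h2 : conv μ β = β := ext_of_pairing fun f ↦ by
    rw [pairing_conv]
    refine pairing_eq_of_shift hC hl' hβ fun k ↦ ?_
    rw [← pairing_conv, conv_convPowSucc]
  -- Here `α` is fixed and the limit is taken in the second factor, where `α ∗ μ^k = α` is constant
  -- in `k`; `h4` is the mirror image.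
  have h3 : conv α β = α := ext_of_pairing fun f ↦ by
    rw [pairing_conv]
    refine pairing_eq_of_forall_pow hl' (hβ _) fun k ↦ ?_
    rw [← pairing_conv, conv_convPowSucc_of_conv_eq h1]
  have h4 : conv α β = β := ext_of_pairing fun f ↦ by
    rw [pairing_conv_swap]
    refine pairing_eq_of_forall_pow hl (hα _) fun k ↦ ?_
    rw [← pairing_conv_swap, convPowSucc_conv_of_conv_eq h2]
  rw [← h3, h4]

theorem tendsto_vagueTopology_iff {ι : Type*} {l : Filter ι} {ν : ι → M G} {α : M G} :
    Tendsto ν l (@nhds (M G) (vagueTopology G) α) ↔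
      ∀ f, Tendsto (fun i ↦ pairing (ν i).1 f) l (𝓝 (pairing α.1 f)) := by
  rw [nhds_induced, tendsto_comap_iff, tendsto_pi_nhds]
  rfl

end Ergodic

end VagueErgodic

end

theorem theorem3p4 {G : Type*} [Group G] [TopologicalSpace G] [IsTopologicalGroup G]
    [LocallyCompactSpace G] [T2Space G] [MeasurableSpace G] [BorelSpace G]
    (μ : VagueErgodic.M G) (hμ : ∃ C : ℝ, ∀ k : ℕ, ‖VagueErgodic.convPowSucc μ k‖ ≤ C) :
    VagueErgodic.IsVagueErgodic μ := by
  obtain ⟨C, hC⟩ := hμ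
  have hlim (U : Ultrafilter ℕ) :=
    VagueErgodic.exists_tendsto_pairing U _ (VagueErgodic.norm_cesaro_le hC)
  obtain ⟨α, hα⟩ := hlim (Ultrafilter.of Filter.atTop)
  refine ⟨α, VagueErgodic.tendsto_vagueTopology_iff.2 fun f ↦ ?_⟩
  -- Convergence is tested on the ultrafilters finer than `atTop`: each has a limit `β`, which must
  -- equal the reference limit `α`.
  refine (Filter.tendsto_iff_ultrafilter _ _ _).2 fun U hU ↦ ?_
  obtain ⟨β, hβ⟩ := hlim U
  rw [VagueErgodic.cesaro_limit_unique hC (Ultrafilter.of_le _) hU hα hβ]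
  exact hβ f
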